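/- All graphs are finite and simple, and all graph classes are hereditary (closed under isomorphism and under taking induced subgraphs). A class $\mathcal{A}$ is $\chi$-bounded if there is a non-decreasing $f:\mathbb{N}\to\mathbb{N}$ with $\chi(G)\le f(\omega(G))$ for all $G\in\mathcal{A}$. The graph-intersection of classes $\mathcal{A}$ and $\mathcal{B}$ is the class of all graphs $G_1\cap G_2=(V(G_1)\cap V(G_2),E(G_1)\cap E(G_2))$ with $G_1\in\mathcal{A}$, $G_2\in\mathcal{B}$. The class $\mathcal{A}$ is intersectionwise $\chi$-guarding if its graph-intersection with every $\chi$-bounded class is $\chi$-bounded. A graph $G$ is trivially perfect if in every non-empty induced subgraph of $G$ the independence number equals the number of maximal cliques. A graph is strongly chordal if it has no induced cycle of length at least $4$ and every cycle of even length at least $6$ in it has a chord joining two vertices at odd distance in the cycle. A Burling tree is a tuple $(T,r,l,c)$ in which $T$ is a finite tree with root $r$; $l$ assigns to each non-leaf vertex one of its children, its last-born; and $c$ assigns to each vertex $v$ a set of vertices: if $v$ is the root or a last-born, then $c(v)=\emptyset$, and otherwise $c(v)$ is the vertex set of a (possibly empty) descending path starting at the last-born of the parent of $v$. Let $C(T)$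 be the graph on $V(T)$ in which distinct $u,v$ are adjacent if and only if $v\in c(u)$, or $u\in c(v)$, or $u$ and $v$ lie on a common path from the root to a leaf. The class $\mathcal{C}$ of Burling strongly chordal graphs consists of the graphs isomorphic to an induced subgraph of some $C(T)$. The Burling sequence $(G_k)_{k\ge1}$ is defined together with sets $\mathcal{S}_k$ of subsets of $V(G_k)$. The graph $G_1$ has one vertex, and $\mathcal{S}_1=\{V(G_1)\}$. The graph $G_{k+1}$ is the disjoint union of a copy of $G_k$ and, for each $S\in\mathcal{S}_k$, a further copy $G_k^S$ of $G_k$, together with, for all $S,Q\in\mathcal{S}_k$, a new vertex $v_{S,Q}$ adjacent precisely to the copy $Q^S$ of $Q$ in $G_k^S$. The set $\mathcal{S}_{k+1}$ consists of the sets $S\cup Q^S$ and $S\cup\{v_{S,Q}\}$ for $S,Q\in\mathcal{S}_k$, where $S$ is taken in the first copy of $G_k$. A Burling graph is a graph isomorphic to an induced subgraph of some $G_k$. **Theorem.** The class of trivially perfect graphs is not intersectionwise $\chi$-guarding. Moreover, the class $\mathcal{C}$ is $\chi$-bounded, every graph in $\mathcal{C}$ is strongly chordal, and the graph-intersection of the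 class of trivially perfect graphs with $\mathcal{C}$ contains every Burling graph; every Burling graph is triangle-free, and $\chi(G_k)\ge k$ for every $k\ge1$. -/

import Mathlib

open scoped SimpleGraph

/-- A hereditary class of finite graphs: closed under isomorphism and induced subgraphs
(`H ⊴ G` says that `H` is isomorphic to an induced subgraph of `G`). -/
structure GraphClass where
  Mem : ∀ {V : Type}, SimpleGraph V → Prop
  finite : ∀ {V : Type} {G : SimpleGraph V}, Mem G → Finite V
  hereditary : ∀ {V W : Type} {G : SimpleGraph V} {H : SimpleGraph W}, H ⊴ G → Mem G → Mem H

namespace GraphClass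

/-- `χ(G) ≤ f(ω(G))` on the class, for some non-decreasing `f`. -/
def ChiBounded (A : GraphClass) : Prop :=
  ∃ f : ℕ → ℕ, Monotone f ∧
    ∀ (V : Type) (G : SimpleGraph V), A.Mem G → G.chromaticNumber ≤ (f G.cliqueNum : ℕ∞)

/-- The graph-intersection of two classes: all graphs `G₁ ∩ G₂` with `G₁ ∈ A` and `G₂ ∈ B`, up to
isomorphism, where `V(G₁ ∩ G₂) = V(G₁) ∩ V(G₂)` and `E(G₁ ∩ G₂) = E(G₁) ∩ E(G₂)`.
The two vertex sets need not be equal; `e₁` and `e₂` are the inclusions of the common part. -/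
def inter (A B : GraphClass) : GraphClass where
  Mem {V} G := ∃ (V₁ V₂ : Type) (G₁ : SimpleGraph V₁) (G₂ : SimpleGraph V₂) (e₁ : V ↪ V₁)
    (e₂ : V ↪ V₂), A.Mem G₁ ∧ B.Mem G₂ ∧
      ∀ u v, G.Adj u v ↔ G₁.Adj (e₁ u) (e₁ v) ∧ G₂.Adj (e₂ u) (e₂ v)
  finite := by
    rintro V G ⟨V₁, V₂, G₁, G₂, e₁, e₂, h₁, h₂, h⟩
    have := A.finite h₁
    exact Finite.of_injective e₁ e₁.injective
  hereditary := by
    rintro V W G H ⟨f⟩ ⟨V₁, V₂, G₁, G₂, e₁, e₂, h₁, h₂, h⟩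
    refine ⟨V₁, V₂, G₁, G₂, f.toEmbedding.trans e₁, f.toEmbedding.trans e₂, h₁, h₂, fun u v => ?_⟩
    exact f.map_adj_iff.symm.trans (h (f u) (f v))

/-- The graph-intersection with every χ-bounded class is χ-bounded. -/
def IntersectionwiseChiGuarding (A : GraphClass) : Prop :=
  ∀ B : GraphClass, B.ChiBounded → (A.inter B).ChiBounded

end GraphClass

/-- Trivially perfect graphs: in every induced subgraph with at least one vertex, the independence
number equals the number of maximal cliques. -/
def triviallyPerfect : GraphClass where
  Mem {V} G := Finite V ∧ ∀ (W : Type) (H : SimpleGraph W), Nonempty W → H ⊴ G →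
    H.indepNum = {K : Set W | Maximal H.IsClique K}.ncard
  finite h := h.1
  hereditary := by
    rintro V W G H hHG ⟨hV, h⟩
    refine ⟨?_, fun X K hX hK => h X K hX (hK.trans hHG)⟩
    obtain ⟨f⟩ := hHG
    exact Finite.of_injective f f.injective

/-- No induced cycle of length at least four. -/
def IsChordal {V : Type} (G : SimpleGraph V) : Prop :=
  ∀ n : ℕ, 4 ≤ n → ¬ SimpleGraph.cycleGraph n ⊴ G

/-- A chordal graph in which every (not necessarily induced) cycle of even length at least six has
a chord joining two vertices at odd distance in the cycle. -/
def IsStronglyChordal {V : Type} (G : SimpleGraph V) : Prop :=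
  IsChordal G ∧ ∀ l : ℕ, 3 ≤ l → ∀ c : SimpleGraph.Copy (SimpleGraph.cycleGraph (2 * l)) G,
    ∃ i j : Fin (2 * l), G.Adj (c i) (c j) ∧ ¬ (SimpleGraph.cycleGraph (2 * l)).Adj i j ∧
      i.val % 2 ≠ j.val % 2

/-- A Burling tree `(T, r, l, c)`. In the ancestor order of the rooted tree `T`, the root `r` is
`⊥`, `u ≤ v` says that `u` is an ancestor of `v`, `u ⋖ v` that `v` is a child of `u`, `Order.pred v`
is the parent of `v ≠ ⊥`, the leaves are the maximal elements, and the (non-empty) branches are the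
intervals `Set.Icc a b` with `a ≤ b`. The value of `lastBorn` at a leaf is irrelevant. -/
structure BurlingTree where
  T : RootedTree.{0}
  finite : Finite T
  lastBorn : T → T
  lastBorn_child : ∀ v : T, ¬ IsMax v → v ⋖ lastBorn v
  choose : T → Set T
  choose_branch : ∀ v : T, v ≠ ⊥ → lastBorn (Order.pred v) ≠ v →
    choose v = ∅ ∨
      ∃ b, lastBorn (Order.pred v) ≤ b ∧ choose v = Set.Icc (lastBorn (Order.pred v)) b
  choose_root : choose ⊥ = ∅
  choose_lastBorn : ∀ v : T, ¬ IsMax v → choose (lastBorn v) = ∅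

namespace BurlingTree

/-- `G(T)`: `u` and `v` are adjacent iff `v ∈ c(u)` or `u ∈ c(v)`. -/
def derivedGraph (B : BurlingTree) : SimpleGraph B.T :=
  SimpleGraph.fromRel fun u v => v ∈ B.choose u

/-- `C(T)`: the graph `G(T)` with every principal branch (the vertices on the path from the root
to a leaf) made a clique. -/
def chordalGraph (B : BurlingTree) : SimpleGraph B.T :=
  B.derivedGraph ⊔ SimpleGraph.fromRel fun u v => ∃ b : B.T, IsMax b ∧ u ≤ b ∧ v ≤ b

end BurlingTree

/-- Burling strongly chordal graphs: the induced subgraphs of the graphs `C(T)`. -/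
def burlingStronglyChordal : GraphClass where
  Mem {_} G := ∃ B : BurlingTree, G ⊴ B.chordalGraph
  finite := by
    rintro V G ⟨B, ⟨f⟩⟩
    have := B.finite
    exact Finite.of_injective f f.injective
  hereditary := by
    rintro V W G H hHG ⟨B, hB⟩
    exact ⟨B, hHG.trans hB⟩

/-- A graph with an indexed family of vertex subsets. -/
structure GraphWithSets where
  V : Type
  graph : SimpleGraph V
  I : Type
  sets : I → Set V

namespace GraphWithSets

/-- Vertices of the next graph in the Burling sequence: one copy of `V`, a further copy of `V` for
each `s : I`, and a new vertex `v_{s,q}` for each `s q : I`. -/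
abbrev NextV (X : GraphWithSets) : Type := X.V ⊕ (X.I × X.V) ⊕ (X.I × X.I)

/-- Adjacency of the next graph: the copies of the graph are kept, and `v_{s,q}` is adjacent
precisely to the copy of the set with index `q` in the copy of the graph with index `s`. -/
def nextAdj (X : GraphWithSets) : X.NextV → X.NextV → Prop
  | .inl a, .inl b => X.graph.Adj a b
  | .inr (.inl (s, a)), .inr (.inl (t, b)) => s = t ∧ X.graph.Adj a b
  | .inr (.inr (s, q)), .inr (.inl (t, b)) => s = t ∧ b ∈ X.sets q
  | .inr (.inl (t, b)), .inr (.inr (s, q)) => s = t ∧ b ∈ X.sets q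
  | _, _ => False

/-- One step of Burling's construction. The new sets are, for all `s q : I`, the set `s` in the
first copy together with either the set `q` in the copy with index `s`, or the vertex `v_{s,q}`. -/
def next (X : GraphWithSets) : GraphWithSets where
  V := X.NextV
  graph :=
    { Adj := X.nextAdj
      symm := ⟨by
        rintro (a | ⟨s, a⟩ | ⟨s, q⟩) (b | ⟨t, b⟩ | ⟨t, p⟩) h <;> simp only [nextAdj] at h ⊢
        · exact h.symm
        · exact ⟨h.1.symm, h.2.symm⟩
        · exact h
        · exact h⟩
      loopless := ⟨by rintro (a | ⟨s, a⟩ | ⟨s, q⟩) h <;> simp [nextAdj] at h⟩ }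
  I := (X.I × X.I) ⊕ (X.I × X.I)
  sets
    | .inl (s, q) => Sum.inl '' X.sets s ∪ (fun b => Sum.inr (Sum.inl (s, b))) '' X.sets q
    | .inr (s, q) => Sum.inl '' X.sets s ∪ {Sum.inr (Sum.inr (s, q))}

end GraphWithSets

/-- Burling's construction: it starts from the one-vertex graph with its vertex set as the only
distinguished set. -/
def burlingSystem : ℕ → GraphWithSets
  | 0 => ⟨Unit, ⊥, Unit, fun _ => Set.univ⟩
  | n + 1 => (burlingSystem n).next

theorem burlingSystem_finite (n : ℕ) : Finite (burlingSystem n).V ∧ Finite (burlingSystem n).I := by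
  induction n with
  | zero => exact ⟨inferInstanceAs (Finite Unit), inferInstanceAs (Finite Unit)⟩
  | succ n ih =>
    obtain ⟨h₁, h₂⟩ := ih
    exact ⟨inferInstanceAs (Finite (burlingSystem n).NextV),
      inferInstanceAs (Finite (((burlingSystem n).I × (burlingSystem n).I) ⊕
        ((burlingSystem n).I × (burlingSystem n).I)))⟩

/-- The Burling sequence, indexed from zero: `burlingGraph n` is the graph usually called
`G_{n+1}`. -/
def burlingGraph (n : ℕ) : SimpleGraph (burlingSystem n).V := (burlingSystem n).graph

/-- Burling graphs: the induced subgraphs of the graphs in the Burling sequence. -/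
def burlingGraphs : GraphClass where
  Mem {_} G := ∃ n : ℕ, G ⊴ burlingGraph n
  finite := by
    rintro V G ⟨n, ⟨f⟩⟩
    have := (burlingSystem_finite n).1
    exact Finite.of_injective f f.injective
  hereditary := by
    rintro V W G H hHG ⟨n, hn⟩
    exact ⟨n, hHG.trans hn⟩

/-- Every non-empty set `S` of vertices contains a vertex `v` that is simple in the subgraph induced
by `S`: the closed neighbourhoods of the neighbours of `v` are linearly ordered by inclusion. -/
def HasSimpleVertices {V : Type} (G : SimpleGraph V) : Prop :=
  ∀ S : Set V, S.Nonempty → ∃ v ∈ S, ∀ x ∈ S, ∀ y ∈ S, G.Adj v x → G.Adj v y →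
    (∀ z ∈ S, z = x ∨ G.Adj x z → z = y ∨ G.Adj y z) ∨
    (∀ z ∈ S, z = y ∨ G.Adj y z → z = x ∨ G.Adj x z)

namespace HasSimpleVertices

variable {V W : Type} {G : SimpleGraph V} {H : SimpleGraph W}

theorem of_isIndContained (hG : HasSimpleVertices G) (h : H ⊴ G) : HasSimpleVertices H := by
  obtain ⟨f⟩ := h
  intro S hS
  obtain ⟨_, ⟨v, hv, rfl⟩, h⟩ := hG (f '' S) (hS.image f)
  refine ⟨v, hv, fun x hx y hy hvx hvy => ?_⟩
  have := h (f x) ⟨x, hx, rfl⟩ (f y) ⟨y, hy, rfl⟩ (f.map_adj_iff.2 hvx) (f.map_adj_iff.2 hvy)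
  simpa only [Set.forall_mem_image, f.map_adj_iff, f.injective.eq_iff] using this

/-- A coloring with `ω(G)` colors, obtained greedily. -/
theorem colorable_cliqueNum [Finite V] (hG : HasSimpleVertices G) : G.Colorable G.cliqueNum := by
  classical
  have := Fintype.ofFinite V
  suffices h : ∀ S : Finset V, ∃ f : V → ℕ, ∀ x ∈ S, f x < G.cliqueNum ∧
      ∀ y ∈ S, G.Adj x y → f x ≠ f y by
    obtain ⟨f, hf⟩ := h Finset.univ
    exact ⟨SimpleGraph.Coloring.mk (fun x => ⟨f x, (hf x (Finset.mem_univ x)).1⟩) fun {x y} hxy h =>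
      (hf x (Finset.mem_univ x)).2 y (Finset.mem_univ y) hxy (Fin.ext_iff.1 h)⟩
  intro S
  induction S using Finset.strongInduction with
  | H S ih =>
    obtain rfl | hS := S.eq_empty_or_nonempty
    · exact ⟨0, by simp⟩
    obtain ⟨v, hv, hsimple⟩ := hG S hS
    have hvS : v ∈ S := hv
    obtain ⟨f, hf⟩ := ih (S.erase v) (Finset.erase_ssubset hvS)
    set N := {x ∈ S | G.Adj v x} with hN
    have hclique : G.IsClique (insert v N : Finset V) := by
      rw [Finset.coe_insert, SimpleGraph.isClique_insert]
      refine ⟨fun x hx y hy hxy => ?_, fun x hx _ => (Finset.mem_filter.1 hx).2⟩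
      obtain ⟨hxS, hx⟩ := Finset.mem_filter.1 hx
      obtain ⟨hyS, hy⟩ := Finset.mem_filter.1 hy
      rcases hsimple x hxS y hyS hx hy with h | h
      · exact ((h x hxS (Or.inl rfl)).resolve_left hxy).symm
      · exact (h y hyS (Or.inl rfl)).resolve_left hxy.symm
    have hcard : (N.image f).card < G.cliqueNum := by
      have h₁ := hclique.card_le_cliqueNum
      rw [Finset.card_insert_of_notMem (by simp [hN])] at h₁
      exact Finset.card_image_le.trans_lt h₁
    obtain ⟨c, hc, hcN⟩ : ∃ c ∈ Finset.range G.cliqueNum, c ∉ N.image f :=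
      Finset.exists_mem_notMem_of_card_lt_card (by simpa using hcard)
    have hne : ∀ x ∈ S, G.Adj v x → f x ≠ c := fun x hx hvx h =>
      hcN (Finset.mem_image.2 ⟨x, Finset.mem_filter.2 ⟨hx, hvx⟩, h⟩)
    refine ⟨Function.update f v c, fun x hx => ?_⟩
    by_cases hxv : x = v
    · subst hxv
      refine ⟨by simpa using hc, fun y hy hxy => ?_⟩
      simpa [Function.update_of_ne hxy.ne'] using (hne y hy hxy).symm
    · rw [Function.update_of_ne hxv]
      obtain ⟨h₁, h₂⟩ := hf x (Finset.mem_erase.2 ⟨hxv, hx⟩)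
      refine ⟨h₁, fun y hy hxy => ?_⟩
      by_cases hyv : y = v
      · subst hyv
        simpa using hne x hx hxy.symm
      · rw [Function.update_of_ne hyv]
        exact h₂ y (Finset.mem_erase.2 ⟨hyv, hy⟩) hxy

end HasSimpleVertices

theorem cycleGraph_adj_iff_val {n : ℕ} (hn : 3 ≤ n) {i j : Fin n} :
    (SimpleGraph.cycleGraph n).Adj i j ↔ i.val + 1 = j.val ∨ j.val + 1 = i.val ∨
      (i.val = 0 ∧ j.val + 1 = n) ∨ (j.val = 0 ∧ i.val + 1 = n) := by
  rw [SimpleGraph.cycleGraph_adj']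
  have hi := i.isLt
  have hj := j.isLt
  rcases lt_trichotomy i j with h | h | h
  · rw [Fin.coe_sub_iff_lt.2 h, Fin.coe_sub_iff_le.2 h.le]
    rw [Fin.lt_def] at h
    omega
  · subst h
    rw [Fin.coe_sub_iff_le.2 le_rfl]
    omega
  · rw [Fin.coe_sub_iff_lt.2 h, Fin.coe_sub_iff_le.2 h.le]
    rw [Fin.lt_def] at h
    omega

/-- The vertices around a given vertex `i` of a cycle: `b i c` is the path centred at `i`, and `a`
and `d` are the vertices that precede `b` and follow `c`. -/
theorem exists_cycleGraph_neighbors {n : ℕ} (hn : 4 ≤ n) (i : Fin n) :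
    ∃ a b c d : Fin n, (SimpleGraph.cycleGraph n).Adj i b ∧ (SimpleGraph.cycleGraph n).Adj i c ∧
      (SimpleGraph.cycleGraph n).Adj b a ∧ (SimpleGraph.cycleGraph n).Adj c d ∧ b ≠ c ∧
      ¬ (SimpleGraph.cycleGraph n).Adj b c ∧
      (6 ≤ n → n % 2 = 0 → d ≠ b ∧ a ≠ c ∧ ¬ (SimpleGraph.cycleGraph n).Adj b d ∧
        ¬ (SimpleGraph.cycleGraph n).Adj c a ∧ b.val % 2 ≠ d.val % 2 ∧ c.val % 2 ≠ a.val % 2) := by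
  have hi := i.isLt
  simp only [cycleGraph_adj_iff_val (show 3 ≤ n by omega), ne_eq, Fin.ext_iff]
  have hshift : ∀ k < n, ∃ j : Fin n, i.val + k = j.val ∨ i.val + k = j.val + n := fun k hk => by
    by_cases h : i.val + k < n
    · exact ⟨⟨i.val + k, h⟩, Or.inl rfl⟩
    · exact ⟨⟨i.val + k - n, by omega⟩, Or.inr (by dsimp only; omega)⟩
  obtain ⟨a, ha⟩ := hshift (n - 2) (by omega)
  obtain ⟨b, hb⟩ := hshift (n - 1) (by omega)
  obtain ⟨c, hc⟩ := hshift 1 (by omega)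
  obtain ⟨d, hd⟩ := hshift 2 (by omega)
  have ha' := a.isLt
  have hb' := b.isLt
  have hc' := c.isLt
  have hd' := d.isLt
  refine ⟨a, b, c, d, ?_, ?_, ?_, ?_, ?_, ?_, fun _ _ => ⟨?_, ?_, ?_, ?_, ?_, ?_⟩⟩ <;> omega

namespace HasSimpleVertices

variable {V : Type} {G : SimpleGraph V}

theorem isChordal (hG : HasSimpleVertices G) : IsChordal G := by
  intro n hn h
  obtain ⟨i, -, hi⟩ := hG.of_isIndContained h Set.univ ⟨⟨0, by omega⟩, trivial⟩
  obtain ⟨a, b, c, d, hib, hic, -, -, hbc, hnadj, -⟩ := exists_cycleGraph_neighbors hn i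
  rcases hi b trivial c trivial hib hic with h | h
  · exact (h b trivial (Or.inl rfl)).elim hbc fun h => hnadj h.symm
  · exact (h c trivial (Or.inl rfl)).elim hbc.symm hnadj

theorem isStronglyChordal (hG : HasSimpleVertices G) : IsStronglyChordal G := by
  refine ⟨hG.isChordal, fun l hl f => ?_⟩
  obtain ⟨_, ⟨i, rfl⟩, hi⟩ := hG (Set.range f) ⟨f ⟨0, by omega⟩, Set.mem_range_self _⟩
  obtain ⟨a, b, c, d, hib, hic, hba, hcd, -, -, h⟩ := exists_cycleGraph_neighbors
    (show 4 ≤ 2 * l by omega) i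
  obtain ⟨hdb, hac, hbd, hca, hbd', hca'⟩ := h (by omega) (by omega)
  rcases hi (f b) ⟨b, rfl⟩ (f c) ⟨c, rfl⟩ (f.toHom.map_adj hib) (f.toHom.map_adj hic) with h | h
  · exact ⟨c, a, (h (f a) ⟨a, rfl⟩ (Or.inr (f.toHom.map_adj hba))).resolve_left
      fun h => hac (f.injective h), hca, hca'⟩
  · exact ⟨b, d, (h (f d) ⟨d, rfl⟩ (Or.inr (f.toHom.map_adj hcd))).resolve_left
      fun h => hdb (f.injective h), hbd, hbd'⟩

end HasSimpleVertices

namespace BurlingTree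

variable (B : BurlingTree)

/-- `u` is a child other than the last-born one, and `l` is the last-born child of its parent. -/
def LastBornSibling (u l : B.T) : Prop :=
  u ≠ ⊥ ∧ B.lastBorn (Order.pred u) ≠ u ∧ B.lastBorn (Order.pred u) = l

variable {B} {u v l x y : B.T}

theorem le_total_of_le (hx : x ≤ v) (hy : y ≤ v) : x ≤ y ∨ y ≤ x :=
  (le_total_of_directed hx hy).symm

theorem LastBornSibling.unique {l' : B.T} (h : B.LastBornSibling u l)
    (h' : B.LastBornSibling u l') : l = l' :=
  h.2.2.symm.trans h'.2.2

theorem LastBornSibling.pred_covBy (h : B.LastBornSibling u l) : Order.pred u ⋖ l := by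
  have : Order.pred u < u := Order.pred_lt_of_not_isMin (by simpa [isMin_iff_eq_bot] using h.1)
  exact h.2.2 ▸ B.lastBorn_child _ this.not_isMax

theorem LastBornSibling.lt_iff (h : B.LastBornSibling u l) : x < u ↔ x < l := by
  constructor
  · exact fun hx => (Order.le_pred_of_lt hx).trans_lt h.pred_covBy.lt
  · intro hx
    have h₁ : x ≤ Order.pred u := by
      rcases le_total_of_le hx.le h.pred_covBy.le with h₁ | h₁
      · exact h₁
      · rcases h₁.lt_or_eq with h₂ | h₂
        · exact (h.pred_covBy.2 h₂ hx).elim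
        · exact h₂.ge
    exact h₁.trans_lt (Order.pred_lt_of_not_isMin (by simpa [isMin_iff_eq_bot] using h.1))

theorem LastBornSibling.ne (h : B.LastBornSibling u l) : u ≠ l :=
  fun he => h.2.1 (h.2.2.trans he.symm)

theorem LastBornSibling.not_le (h : B.LastBornSibling u l) : ¬ u ≤ l := fun hle =>
  lt_irrefl _ (h.lt_iff.2 (lt_of_le_of_ne hle h.ne))

theorem LastBornSibling.not_ge (h : B.LastBornSibling u l) : ¬ l ≤ u := fun hle =>
  lt_irrefl _ (h.lt_iff.1 (lt_of_le_of_ne hle h.ne.symm))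

theorem LastBornSibling.not_le_of_le (h : B.LastBornSibling u l) (hl : l ≤ v) : ¬ u ≤ v :=
  fun hu => (le_total_of_le hu hl).elim h.not_le h.not_ge

theorem LastBornSibling.lt_lastBorn_of_le {m : B.T} (hu : B.LastBornSibling u l)
    (hv : B.LastBornSibling v m) (h : l ≤ v) : l < m := by
  refine hv.lt_iff.1 (lt_of_le_of_ne h ?_)
  rintro rfl
  have hp := hu.2.2
  rw [← hu.pred_covBy.pred_eq] at hp
  exact hv.2.1 hp

theorem exists_lastBornSibling_of_mem_choose (h : v ∈ B.choose u) :
    ∃ l, B.LastBornSibling u l ∧ l ≤ v ∧ ∀ x, l ≤ x → x ≤ v → x ∈ B.choose u := by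
  have hu : u ≠ ⊥ := by
    rintro rfl
    simp [B.choose_root] at h
  have hpred : Order.pred u < u := Order.pred_lt_of_not_isMin (by simpa [isMin_iff_eq_bot] using hu)
  have hne : B.lastBorn (Order.pred u) ≠ u := by
    intro he
    have := B.choose_lastBorn _ hpred.not_isMax
    rw [he] at this
    simp [this] at h
  rcases B.choose_branch u hu hne with he | ⟨b, hb, he⟩
  · simp [he] at h
  · rw [he] at h ⊢
    exact ⟨_, ⟨hu, hne, rfl⟩, h.1, fun x hx hxv => ⟨hx, hxv.trans h.2⟩⟩

theorem le_total_of_mem_choose (hx : x ∈ B.choose v) (hy : y ∈ B.choose v) : x ≤ y ∨ y ≤ x := by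
  obtain ⟨l, hl, -, -⟩ := exists_lastBornSibling_of_mem_choose hx
  rcases B.choose_branch v hl.1 hl.2.1 with he | ⟨b, -, he⟩
  · simp [he] at hx
  · rw [he] at hx hy
    exact le_total_of_le hx.2 hy.2

theorem not_le_of_mem_choose (h : v ∈ B.choose u) : ¬ u ≤ v := by
  obtain ⟨l, hl, hlv, -⟩ := exists_lastBornSibling_of_mem_choose h
  exact hl.not_le_of_le hlv

theorem not_ge_of_mem_choose (h : v ∈ B.choose u) : ¬ v ≤ u := by
  obtain ⟨l, hl, hlv, -⟩ := exists_lastBornSibling_of_mem_choose h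
  exact fun hvu => hl.not_ge (hlv.trans hvu)

theorem derivedGraph_adj : B.derivedGraph.Adj u v ↔ v ∈ B.choose u ∨ u ∈ B.choose v := by
  rw [derivedGraph, SimpleGraph.fromRel_adj, and_iff_right_iff_imp]
  rintro (h | h) rfl
  · exact not_le_of_mem_choose h le_rfl
  · exact not_le_of_mem_choose h le_rfl

theorem exists_isMax_ge (v : B.T) : ∃ b, IsMax b ∧ v ≤ b := by
  have := B.finite
  obtain ⟨b, hb, hmax⟩ := (Set.toFinite (Set.Ici v)).exists_maximal ⟨v, le_rfl⟩
  exact ⟨b, fun c hc => hmax (le_trans hb hc) hc, hb⟩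

theorem chordalGraph_adj :
    B.chordalGraph.Adj u v ↔ v ∈ B.choose u ∨ u ∈ B.choose v ∨ u < v ∨ v < u := by
  have key : (∃ b : B.T, IsMax b ∧ u ≤ b ∧ v ≤ b) ↔ u ≤ v ∨ v ≤ u := by
    constructor
    · rintro ⟨b, -, hu, hv⟩
      exact le_total_of_le hu hv
    · rintro (h | h)
      · obtain ⟨b, hb, hle⟩ := exists_isMax_ge v
        exact ⟨b, hb, h.trans hle, hle⟩
      · obtain ⟨b, hb, hle⟩ := exists_isMax_ge u
        exact ⟨b, hb, hle, h.trans hle⟩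
  have key' : (∃ b : B.T, IsMax b ∧ v ≤ b ∧ u ≤ b) ↔ u ≤ v ∨ v ≤ u := by
    rw [← key]
    simp only [and_comm]
  rw [chordalGraph, SimpleGraph.sup_adj, derivedGraph_adj, SimpleGraph.fromRel_adj, key, key',
    or_self, lt_iff_le_and_ne, lt_iff_le_and_ne, ne_comm (a := v)]
  tauto

/-- In `C(T)`, closed neighbourhoods shrink along branches. -/
theorem closedNeighborhood_antitone {z : B.T} (hxy : x ≤ y)
    (hz : z = y ∨ B.chordalGraph.Adj y z) : z = x ∨ B.chordalGraph.Adj x z := by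
  rcases hxy.eq_or_lt with rfl | hlt
  · exact hz
  have hcomp : x ≤ z ∨ z ≤ x → z = x ∨ B.chordalGraph.Adj x z := by
    rw [chordalGraph_adj]
    rintro (h | h) <;> rcases h.eq_or_lt with rfl | h <;> simp_all
  rw [chordalGraph_adj] at hz
  rcases hz with rfl | h | h | h | h
  · exact hcomp (Or.inl hxy)
  · obtain ⟨l, hl, hlz, -⟩ := exists_lastBornSibling_of_mem_choose h
    exact hcomp (Or.inl ((hl.lt_iff.1 hlt).le.trans hlz))
  · obtain ⟨l, hl, hly, hmem⟩ := exists_lastBornSibling_of_mem_choose h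
    by_cases hlx : l ≤ x
    · exact Or.inr (chordalGraph_adj.2 (Or.inr (Or.inl (hmem x hlx hxy))))
    · have hxl : x < l := lt_of_le_not_ge ((le_total_of_le hxy hly).resolve_right hlx) hlx
      exact hcomp (Or.inl (hl.lt_iff.2 hxl).le)
  · exact hcomp (Or.inl (hxy.trans h.le))
  · exact hcomp (le_total_of_le hxy h.le)

variable (B) in
/-- `B.Before v u`: the vertex `v` comes before `u` in depth-first order, when the subtree of the
last-born child is visited before the other children. -/
def Before (v u : B.T) : Prop :=
  v < u ∨ ∃ u' l, u' ≤ u ∧ B.LastBornSibling u' l ∧ l ≤ v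

theorem Before.trans {w : B.T} (hvu : B.Before v u) (hwv : B.Before w v) : B.Before w u := by
  rcases hvu with hvu | ⟨u', l, hu', hl, hlv⟩
  · rcases hwv with hwv | ⟨v', l, hv', hl, hlw⟩
    · exact Or.inl (hwv.trans hvu)
    · exact Or.inr ⟨v', l, hv'.trans hvu.le, hl, hlw⟩
  · rcases hwv with hwv | ⟨v', m, hv', hm, hmw⟩
    · by_cases hlw : l ≤ w
      · exact Or.inr ⟨u', l, hu', hl, hlw⟩
      · have hwl : w < l :=
          lt_of_le_not_ge ((le_total_of_le hwv.le hlv).resolve_right hlw) hlw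
        exact Or.inl ((hl.lt_iff.2 hwl).trans_le hu')
    · by_cases hlv' : l ≤ v'
      · exact Or.inr ⟨u', l, hu', hl, (hl.lt_lastBorn_of_le hm hlv').le.trans hmw⟩
      · have hlt : v' < l :=
          lt_of_le_not_ge ((le_total_of_le hv' hlv).resolve_right hlv') hlv'
        exact Or.inr ⟨v', m, (hl.lt_iff.2 hlt).le.trans hu', hm, hmw⟩

theorem Before.irrefl (u : B.T) : ¬ B.Before u u := by
  rintro (h | ⟨u', l, hu', hl, hlu⟩)
  · exact lt_irrefl _ h
  · exact hl.not_le_of_le hlu hu'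

/-- A vertex of a non-empty set that is last in depth-first order. -/
theorem exists_last (S : Set B.T) (hS : S.Nonempty) : ∃ v ∈ S, ∀ w ∈ S, ¬ B.Before v w := by
  have := B.finite
  let r : B.T → B.T → Prop := fun u v => B.Before v u
  have : IsTrans B.T r := ⟨fun _ _ _ h₁ h₂ => Before.trans h₁ h₂⟩
  have : Std.Irrefl r := ⟨Before.irrefl⟩
  exact (Finite.wellFounded_of_trans_of_irrefl r).has_min S hS

variable (B) in
theorem hasSimpleVertices_chordalGraph : HasSimpleVertices B.chordalGraph := by
  intro S hS
  obtain ⟨v, hv, hlast⟩ := exists_last S hS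
  refine ⟨v, hv, fun x hx y hy hvx hvy => ?_⟩
  have hnbr : ∀ w ∈ S, B.chordalGraph.Adj v w → w ∈ B.choose v ∨ w < v := by
    intro w hw hvw
    rcases chordalGraph_adj.1 hvw with h | h | h | h
    · exact Or.inl h
    · obtain ⟨l, hl, hlv, -⟩ := exists_lastBornSibling_of_mem_choose h
      exact (hlast w hw (Or.inr ⟨w, l, le_rfl, hl, hlv⟩)).elim
    · exact (hlast w hw (Or.inl h)).elim
    · exact Or.inr h
  have hlt : ∀ w w', w ∈ B.choose v → w' < v → w' ≤ w := by
    intro w w' hw hw'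
    obtain ⟨l, hl, hlw, -⟩ := exists_lastBornSibling_of_mem_choose hw
    exact (hl.lt_iff.1 hw').le.trans hlw
  have hchain : x ≤ y ∨ y ≤ x := by
    rcases hnbr x hx hvx with h₁ | h₁ <;> rcases hnbr y hy hvy with h₂ | h₂
    · exact le_total_of_mem_choose h₁ h₂
    · exact Or.inr (hlt x y h₁ h₂)
    · exact Or.inl (hlt y x h₂ h₁)
    · exact le_total_of_le h₁.le h₂.le
  rcases hchain with h | h
  · exact Or.inr fun z _ => closedNeighborhood_antitone h
  · exact Or.inl fun z _ => closedNeighborhood_antitone h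

end BurlingTree

theorem hasSimpleVertices_of_mem_burlingStronglyChordal {V : Type} {G : SimpleGraph V}
    (hG : burlingStronglyChordal.Mem G) : HasSimpleVertices G := by
  obtain ⟨B, hB⟩ := hG
  exact B.hasSimpleVertices_chordalGraph.of_isIndContained hB

theorem burlingStronglyChordal_chiBounded : burlingStronglyChordal.ChiBounded := by
  refine ⟨id, monotone_id, fun V G hG => ?_⟩
  have := burlingStronglyChordal.finite hG
  exact (hasSimpleVertices_of_mem_burlingStronglyChordal hG).colorable_cliqueNum.chromaticNumber_le

/-- The comparability graph of a finite forest order has as many maximal cliques as a largest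
independent set has vertices: both are counted by the maximal elements. -/
theorem indepNum_eq_ncard_maximal_isClique {V : Type} [Finite V] [Nonempty V] [PartialOrder V]
    {G : SimpleGraph V} (hG : ∀ a b, G.Adj a b ↔ a < b ∨ b < a)
    (hforest : ∀ a b c : V, a ≤ c → b ≤ c → a ≤ b ∨ b ≤ a) :
    G.indepNum = {K : Set V | Maximal G.IsClique K}.ncard := by
  classical
  have := Fintype.ofFinite V
  have hmax : ∀ v : V, ∃ m, IsMax m ∧ v ≤ m := fun v => by
    obtain ⟨m, hm, h⟩ := (Set.toFinite (Set.Ici v)).exists_maximal ⟨v, le_rfl⟩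
    exact ⟨m, fun c hc => h (le_trans hm hc) hc, hm⟩
  have hIic : ∀ m : V, G.IsClique (Set.Iic m) := fun m a ha b hb hab => by
    rw [hG]
    exact (hforest a b m ha hb).imp (fun h => lt_of_le_of_ne h hab)
      (fun h => lt_of_le_of_ne h hab.symm)
  have hcl : {K : Set V | Maximal G.IsClique K} = Set.Iic '' {m : V | IsMax m} := by
    ext K
    constructor
    · intro hK
      have hne : K.Nonempty := by
        rw [Set.nonempty_iff_ne_empty]
        rintro rfl
        obtain ⟨v⟩ := ‹Nonempty V›
        exact hK.2 (hIic v) (Set.empty_subset _) (Set.mem_Iic.2 (le_refl v))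
      obtain ⟨k, hk, hkmax⟩ := (Set.toFinite K).exists_maximal hne
      obtain ⟨m, hm, hkm⟩ := hmax k
      refine ⟨m, hm, ?_⟩
      have hsub : K ⊆ Set.Iic m := fun x hx => by
        by_cases hxk : x = k
        · exact hxk ▸ hkm
        · rcases (hG x k).1 (hK.1 hx hk hxk) with h | h
          · exact h.le.trans hkm
          · exact (hkmax hx h.le).trans hkm
      exact (hK.2 (hIic m) hsub).antisymm hsub
    · rintro ⟨m, hm, rfl⟩
      refine ⟨hIic m, fun K hK hsub x hx => ?_⟩
      by_cases hxm : x = m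
      · exact hxm.le
      · rcases (hG x m).1 (hK hx (hsub (Set.mem_Iic.2 le_rfl)) hxm) with h | h
        · exact h.le
        · exact (hm.not_lt h).elim
  rw [hcl, Set.ncard_image_of_injective _ Set.Iic_injective]
  apply le_antisymm
  · obtain ⟨A, hA, hcard⟩ := G.exists_isNIndepSet_indepNum
    choose f hf hle using hmax
    rw [← hcard, ← Set.ncard_coe_finset]
    refine Set.ncard_le_ncard_of_injOn f (fun a _ => hf a) (fun a ha b hb hab => ?_)
    by_contra hne
    refine hA ha hb hne ((hG a b).2 ?_)
    exact (hforest a b (f a) (hle a) (hab ▸ hle b)).imp (fun h => lt_of_le_of_ne h hne)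
      (fun h => lt_of_le_of_ne h (Ne.symm hne))
  · have hind : G.IsIndepSet ({m : V | IsMax m}.toFinset : Set V) := by
      intro a ha b hb _ hab
      simp only [Set.coe_toFinset, Set.mem_ofPred_eq] at ha hb
      exact ((hG a b).1 hab).elim ha.not_lt hb.not_lt
    rw [Set.ncard_eq_toFinset_card']
    exact hind.card_le_indepNum

/-- The comparability graph of a finite forest order is trivially perfect. -/
theorem triviallyPerfect_of_forest {V : Type} [Finite V] {G : SimpleGraph V} (r : V → V → Prop)
    (hirrefl : ∀ a, ¬ r a a) (htrans : ∀ a b c, r a b → r b c → r a c)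
    (hforest : ∀ a b c, r a c → r b c → a = b ∨ r a b ∨ r b a)
    (hG : ∀ a b, G.Adj a b ↔ r a b ∨ r b a) : triviallyPerfect.Mem G := by
  refine ⟨inferInstance, fun W H hW ⟨f⟩ => ?_⟩
  have : Finite W := Finite.of_injective f f.injective
  let s : W → W → Prop := fun a b => r (f a) (f b)
  have : IsStrictOrder W s :=
    { irrefl := fun a => hirrefl (f a)
      trans := fun a b c => htrans (f a) (f b) (f c) }
  let : PartialOrder W := partialOrderOfSO s
  refine indepNum_eq_ncard_maximal_isClique (fun a b => ?_) fun a b c hac hbc => ?_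
  · rw [← f.map_adj_iff, hG]
    rfl
  · rcases hac.eq_or_lt with rfl | hac
    · exact Or.inr hbc
    rcases hbc.eq_or_lt with rfl | hbc
    · exact Or.inl hac.le
    rcases hforest (f a) (f b) (f c) hac hbc with h | h | h
    · exact Or.inl (f.injective h).le
    · exact Or.inl (show a < b from h).le
    · exact Or.inr (show b < a from h).le

namespace BurlingTree

variable (B : BurlingTree)

/-- With respect to an injective ranking `f` of the vertices, a non-last-born `u` lies above the
descendants of its last-born sibling, and above its non-last-born siblings of larger rank. -/
def SiblingAbove (f : B.T → ℕ) (u v : B.T) : Prop :=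
  ∃ l, B.LastBornSibling u l ∧ (l ≤ v ∨ B.LastBornSibling v l ∧ f u < f v)

variable {B} {f : B.T → ℕ}

theorem SiblingAbove.not_le {u v : B.T} (h : B.SiblingAbove f u v) : ¬ u ≤ v := by
  obtain ⟨l, hl, h | ⟨hv, hlt⟩⟩ := h
  · exact hl.not_le_of_le h
  · intro hle
    rcases hle.eq_or_lt with rfl | hle
    · exact lt_irrefl _ hlt
    · exact hl.not_le (hv.lt_iff.1 hle).le

theorem SiblingAbove.not_ge {u v : B.T} (h : B.SiblingAbove f u v) : ¬ v ≤ u := by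
  obtain ⟨l, hl, h | ⟨hv, hlt⟩⟩ := h
  · exact fun hle => hl.not_ge (h.trans hle)
  · intro hle
    rcases hle.eq_or_lt with rfl | hle
    · exact lt_irrefl _ hlt
    · exact hv.not_le (hl.lt_iff.1 hle).le

theorem SiblingAbove.trans {u v w : B.T} (huv : B.SiblingAbove f u v)
    (hvw : B.SiblingAbove f v w) : B.SiblingAbove f u w := by
  obtain ⟨l, hl, huv⟩ := huv
  obtain ⟨m, hm, hvw⟩ := hvw
  refine ⟨l, hl, ?_⟩
  rcases huv with huv | ⟨hv, hlt⟩
  · have hlm := hl.lt_lastBorn_of_le hm huv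
    rcases hvw with hvw | ⟨hw, -⟩
    · exact Or.inl (hlm.le.trans hvw)
    · exact Or.inl (hw.lt_iff.2 hlm).le
  · obtain rfl := hv.unique hm
    exact hvw.imp_right fun h => ⟨h.1, hlt.trans h.2⟩

theorem SiblingAbove.forest (hf : Function.Injective f) {u v w : B.T}
    (huw : B.SiblingAbove f u w) (hvw : B.SiblingAbove f v w) :
    u = v ∨ B.SiblingAbove f u v ∨ B.SiblingAbove f v u := by
  obtain ⟨l, hl, huw⟩ := huw
  obtain ⟨m, hm, hvw⟩ := hvw
  have hcomp : l = m ∨ l < m ∨ m < l := by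
    have hle : l ≤ m ∨ m ≤ l := by
      rcases huw with huw | ⟨hwl, -⟩ <;> rcases hvw with hvw | ⟨hwm, -⟩
      · exact le_total_of_le huw hvw
      · exact Or.inl (hl.lt_lastBorn_of_le hwm huw).le
      · exact Or.inr (hm.lt_lastBorn_of_le hwl hvw).le
      · exact Or.inl (hwl.unique hwm).le
    rcases hle with h | h
    · exact h.eq_or_lt.imp_right Or.inl
    · exact h.eq_or_lt.imp Eq.symm Or.inr
  rcases hcomp with rfl | h | h
  · rcases lt_trichotomy (f u) (f v) with h | h | h
    · exact Or.inr (Or.inl ⟨l, hl, Or.inr ⟨hm, h⟩⟩)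
    · exact Or.inl (hf h)
    · exact Or.inr (Or.inr ⟨l, hm, Or.inr ⟨hl, h⟩⟩)
  · exact Or.inr (Or.inl ⟨l, hl, Or.inl (hm.lt_iff.2 h).le⟩)
  · exact Or.inr (Or.inr ⟨m, hm, Or.inl (hl.lt_iff.2 h).le⟩)

variable (B) in
/-- `G(T)` is the intersection of `C(T)` with a trivially perfect graph on the same vertices. -/
theorem derivedGraph_mem_inter :
    (triviallyPerfect.inter burlingStronglyChordal).Mem B.derivedGraph := by
  have := B.finite
  obtain ⟨n, ⟨e⟩⟩ := Finite.exists_equiv_fin B.T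
  let f : B.T → ℕ := fun v => (e v).val
  have hf : Function.Injective f := fun u v h => e.injective (Fin.ext h)
  have hirrefl : ∀ u, ¬ B.SiblingAbove f u u := fun u h => h.not_le le_rfl
  have hadj : ∀ u v, (SimpleGraph.fromRel (B.SiblingAbove f)).Adj u v ↔
      B.SiblingAbove f u v ∨ B.SiblingAbove f v u := fun u v => by
    rw [SimpleGraph.fromRel_adj, and_iff_right_iff_imp]
    rintro (h | h) rfl <;> exact hirrefl _ h
  refine ⟨B.T, B.T, SimpleGraph.fromRel (B.SiblingAbove f), B.chordalGraph, .refl _, .refl _,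
    triviallyPerfect_of_forest (B.SiblingAbove f) hirrefl (fun _ _ _ => SiblingAbove.trans)
      (fun _ _ _ => SiblingAbove.forest hf) hadj, ⟨B, .rfl⟩, fun u v => ?_⟩
  simp only [Function.Embedding.refl_apply]
  rw [hadj, chordalGraph_adj, derivedGraph_adj]
  have hmem : ∀ {u v}, v ∈ B.choose u → B.SiblingAbove f u v := fun h => by
    obtain ⟨l, hl, hlv, -⟩ := exists_lastBornSibling_of_mem_choose h
    exact ⟨l, hl, Or.inl hlv⟩
  constructor
  · rintro (h | h)
    · exact ⟨Or.inl (hmem h), Or.inl h⟩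
    · exact ⟨Or.inr (hmem h), Or.inr (Or.inl h)⟩
  · rintro ⟨h, h' | h' | h' | h'⟩
    · exact Or.inl h'
    · exact Or.inr h'
    · exact (h.elim (fun h => h.not_le h'.le) fun h => h.not_ge h'.le).elim
    · exact (h.elim (fun h => h.not_ge h'.le) fun h => h.not_le h'.le).elim

end BurlingTree

section FiniteTree

variable {α : Type} [PartialOrder α] [Finite α]

theorem exists_greatest_of_chain {s : Set α} (hs : s.Nonempty)
    (hchain : ∀ a ∈ s, ∀ b ∈ s, a ≤ b ∨ b ≤ a) : ∃ m, IsGreatest s m := by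
  obtain ⟨m, hm, hmax⟩ := (Set.toFinite s).exists_maximal hs
  exact ⟨m, hm, fun a ha => (hchain a ha m hm).elim id (hmax ha)⟩

/-- A finite partial order with a least element in which the elements below any given one form a
chain is a rooted tree. -/
noncomputable def RootedTree.ofChains (root : α) (hroot : ∀ v, root ≤ v)
    (hchain : ∀ a b v : α, a ≤ v → b ≤ v → a ≤ b ∨ b ≤ a) : RootedTree.{0} :=
  letI : OrderBot α := { bot := root, bot_le := hroot }
  have hinf (a b : α) : ∃ m, IsGreatest {x | x ≤ a ∧ x ≤ b} m :=
    exists_greatest_of_chain ⟨⊥, bot_le, bot_le⟩ fun x hx y hy => hchain x y a hx.1 hy.1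
  have hpred (v : α) : ∃ m, m ≤ v ∧ (v ≤ m → IsMin v) ∧ ∀ x < v, x ≤ m := by
    by_cases hv : v = ⊥
    · subst hv
      exact ⟨⊥, le_rfl, fun _ => isMin_bot, fun x hx => hx.le⟩
    · obtain ⟨m, hm, hmax⟩ := exists_greatest_of_chain (s := Set.Iio v)
        ⟨⊥, bot_lt_iff_ne_bot.2 hv⟩ fun x hx y hy => hchain x y v (le_of_lt hx) (le_of_lt hy)
      exact ⟨m, le_of_lt hm, fun h => (not_lt_of_ge h hm).elim, fun x hx => hmax hx⟩
  letI : SemilatticeInf α :=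
    { (inferInstance : PartialOrder α) with
      inf := fun a b => (hinf a b).choose
      inf_le_left := fun a b => (hinf a b).choose_spec.1.1
      inf_le_right := fun a b => (hinf a b).choose_spec.1.2
      le_inf := fun a b c hab hac => (hinf b c).choose_spec.2 ⟨hab, hac⟩ }
  letI : PredOrder α :=
    { pred := fun v => (hpred v).choose
      pred_le := fun v => (hpred v).choose_spec.1
      min_of_le_pred := fun {v} => (hpred v).choose_spec.2.1
      le_pred_of_lt := fun {x v} => (hpred v).choose_spec.2.2 x }
  haveI : IsPredArchimedean α :=
    { exists_pred_iterate_of_le := fun {a b} hab => by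
        induction b using WellFoundedLT.induction with
        | ind b ih =>
          rcases hab.eq_or_lt with rfl | hlt
          · exact ⟨0, rfl⟩
          · obtain ⟨n, hn⟩ := ih (Order.pred b) (Order.pred_lt_of_not_isMin hlt.not_isMin)
              (Order.le_pred_of_lt hlt)
            exact ⟨n + 1, hn⟩ }
  ⟨α⟩

end FiniteTree

theorem RootedTree.pred_eq_of_covBy (T : RootedTree) {p v : T} (h : p ⋖ v) : Order.pred v = p :=
  h.pred_eq

/-- A Burling tree on the vertices of `X.graph` whose derived graph is `X.graph` and whose principal
branches are the distinguished sets of `X`. -/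
structure BurlingOrder (X : GraphWithSets) extends PartialOrder X.V where
  root : X.V
  root_le : ∀ v, root ≤ v
  le_total_of_le : ∀ a b v : X.V, a ≤ v → b ≤ v → a ≤ b ∨ b ≤ a
  lastBorn : X.V → X.V
  lastBorn_child : ∀ v, ¬ IsMax v → v ⋖ lastBorn v
  leaf : X.I → X.V
  leaf_injective : Function.Injective leaf
  isMax_iff : ∀ v, IsMax v ↔ ∃ s, leaf s = v
  mem_sets : ∀ s v, v ∈ X.sets s ↔ v ≤ leaf s
  choose : X.V → Set X.V
  choose_branch : ∀ v, choose v = ∅ ∨ ∃ p b, p ⋖ v ∧ lastBorn p ≠ v ∧ lastBorn p ≤ b ∧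
    choose v = Set.Icc (lastBorn p) b
  adj_iff : ∀ u v, X.graph.Adj u v ↔ v ∈ choose u ∨ u ∈ choose v

namespace BurlingOrder

variable {X : GraphWithSets}

/-- The Burling tree given by a Burling order on a finite vertex set. -/
noncomputable def toBurlingTree [Finite X.V] (O : BurlingOrder X) : BurlingTree :=
  letI := O.toPartialOrder
  let T := RootedTree.ofChains O.root O.root_le O.le_total_of_le
  { T := T
    finite := inferInstanceAs (Finite X.V)
    lastBorn := O.lastBorn
    lastBorn_child := O.lastBorn_child
    choose := O.choose
    choose_branch := fun v _ _ => by
      rcases O.choose_branch v with h | ⟨p, b, hp, -, hb, h⟩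
      · exact Or.inl h
      · rw [T.pred_eq_of_covBy hp]
        exact Or.inr ⟨b, hb, h⟩
    choose_root := by
      rcases O.choose_branch O.root with h | ⟨p, b, hp, -⟩
      · exact h
      · exact (not_lt_of_ge (O.root_le p) hp.lt).elim
    choose_lastBorn := fun v hv => by
      rcases O.choose_branch (O.lastBorn v) with h | ⟨p, b, hp, hne, -⟩
      · exact h
      · have hpv : p = v := (T.pred_eq_of_covBy hp).symm.trans
          (T.pred_eq_of_covBy (O.lastBorn_child v hv))
        exact (hne (congrArg O.lastBorn hpv)).elim }

theorem isIndContained_derivedGraph [Finite X.V] (O : BurlingOrder X) :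
    X.graph ⊴ O.toBurlingTree.derivedGraph :=
  ⟨⟨Function.Embedding.refl X.V, fun {u v} =>
    (BurlingTree.derivedGraph_adj (B := O.toBurlingTree) (u := u) (v := v)).trans
      (O.adj_iff u v).symm⟩⟩

end BurlingOrder

namespace BurlingOrder

variable {X : GraphWithSets}

/-- The ancestor order of the tree obtained by attaching, below each leaf `s`, a copy of the tree as
the last-born subtree, and the vertices `v_{s,q}` as further children. -/
def nextLe (O : BurlingOrder X) : X.NextV → X.NextV → Prop
  | .inl a, .inl b => O.le a b
  | .inl a, .inr (.inl (s, _)) => O.le a (O.leaf s)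
  | .inl a, .inr (.inr (s, _)) => O.le a (O.leaf s)
  | .inr (.inl (s, a)), .inr (.inl (t, b)) => s = t ∧ O.le a b
  | .inr (.inr (s, q)), .inr (.inr (t, p)) => s = t ∧ q = p
  | _, _ => False

/-- The order `nextLe` as a partial order. -/
@[reducible]
def nextOrder (O : BurlingOrder X) : PartialOrder X.next.V where
  le := O.nextLe
  le_refl := by
    rintro (a | ⟨s, a⟩ | ⟨s, q⟩)
    · exact O.le_refl a
    · exact ⟨rfl, O.le_refl a⟩
    · exact ⟨rfl, rfl⟩
  le_trans := by
    rintro (a | ⟨s, a⟩ | ⟨s, q⟩) (b | ⟨t, b⟩ | ⟨t, p⟩) (c | ⟨u, c⟩ | ⟨u, r⟩) h₁ h₂ <;>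
      simp only [nextLe] at h₁ h₂ ⊢
    · exact O.le_trans _ _ _ h₁ h₂
    · exact O.le_trans _ _ _ h₁ h₂
    · exact O.le_trans _ _ _ h₁ h₂
    · exact h₂.1 ▸ h₁
    · exact h₂.1 ▸ h₁
    · exact ⟨h₁.1.trans h₂.1, O.le_trans _ _ _ h₁.2 h₂.2⟩
    · exact ⟨h₁.1.trans h₂.1, h₁.2.trans h₂.2⟩
  le_antisymm := by
    rintro (a | ⟨s, a⟩ | ⟨s, q⟩) (b | ⟨t, b⟩ | ⟨t, p⟩) h₁ h₂ <;> simp only [nextLe] at h₁ h₂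
    · exact congrArg Sum.inl (O.le_antisymm _ _ h₁ h₂)
    · rw [h₁.1, O.le_antisymm _ _ h₁.2 h₂.2]
    · rw [h₁.1, h₁.2]

/-- The last-born children in the next tree. -/
noncomputable def nextLastBorn (O : BurlingOrder X) : X.NextV → X.NextV
  | .inl a => open Classical in
    if h : ∃ s, O.leaf s = a then .inr (.inl (h.choose, O.root)) else .inl (O.lastBorn a)
  | .inr (.inl (s, a)) => .inr (.inl (s, O.lastBorn a))
  | .inr (.inr p) => .inr (.inr p)

theorem nextLastBorn_leaf (O : BurlingOrder X) (s : X.I) :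
    O.nextLastBorn (.inl (O.leaf s)) = .inr (.inl (s, O.root)) := by
  have h : ∃ t, O.leaf t = O.leaf s := ⟨s, rfl⟩
  simp only [nextLastBorn, dif_pos h, O.leaf_injective h.choose_spec]

theorem nextLastBorn_inl (O : BurlingOrder X) {a : X.V} (h : ¬ ∃ s, O.leaf s = a) :
    O.nextLastBorn (.inl a) = .inl (O.lastBorn a) := by
  simp only [nextLastBorn, dif_neg h]

/-- `O.nextMem u v` says that `v` is chosen by `u` in the next tree. -/
def nextMem (O : BurlingOrder X) : X.NextV → X.NextV → Prop
  | .inl a, .inl b => b ∈ O.choose a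
  | .inr (.inl (s, a)), .inr (.inl (t, b)) => s = t ∧ b ∈ O.choose a
  | .inr (.inr (s, q)), .inr (.inl (t, b)) => s = t ∧ b ∈ X.sets q
  | _, _ => False

theorem next_mem_sets (O : BurlingOrder X) (s q : X.I) (x : X.NextV) :
    (x ∈ (Sum.inl '' X.sets s ∪ (fun b => Sum.inr (Sum.inl (s, b))) '' X.sets q : Set X.NextV) ↔
      O.nextLe x (.inr (.inl (s, O.leaf q)))) ∧
    (x ∈ (Sum.inl '' X.sets s ∪ {Sum.inr (Sum.inr (s, q))} : Set X.NextV) ↔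
      O.nextLe x (.inr (.inr (s, q)))) := by
  rcases x with a | ⟨t, a⟩ | ⟨t, p⟩ <;>
    simp [nextLe, O.mem_sets, eq_comm, and_comm]

theorem nextAdj_iff (O : BurlingOrder X) (u v : X.NextV) :
    X.nextAdj u v ↔ O.nextMem u v ∨ O.nextMem v u := by
  rcases u with a | ⟨s, a⟩ | ⟨s, q⟩ <;> rcases v with b | ⟨t, b⟩ | ⟨t, p⟩ <;>
    simp only [GraphWithSets.nextAdj, nextMem, O.adj_iff, or_false, false_or, or_self]
  · rw [and_or_left, eq_comm (a := t)]

section Covering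

variable (O : BurlingOrder X)

theorem nextOrder_covBy_inl {a b : X.V} (h : @CovBy X.V O.toPartialOrder.toLT a b) :
    @CovBy X.next.V O.nextOrder.toLT (.inl a) (.inl b) := by
  let := O.toPartialOrder
  let := O.nextOrder
  refine ⟨⟨h.lt.le, h.lt.not_ge⟩, ?_⟩
  rintro (c | ⟨s, c⟩ | ⟨s, q⟩) h₁ h₂
  · exact h.2 (c := c) (lt_of_le_not_ge h₁.le h₁.not_ge) (lt_of_le_not_ge h₂.le h₂.not_ge)
  · exact h₂.le
  · exact h₂.le

theorem nextOrder_covBy_copy (s : X.I) {a b : X.V}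
    (h : @CovBy X.V O.toPartialOrder.toLT a b) :
    @CovBy X.next.V O.nextOrder.toLT (.inr (.inl (s, a))) (.inr (.inl (s, b))) := by
  let := O.toPartialOrder
  let := O.nextOrder
  refine ⟨⟨⟨rfl, h.lt.le⟩, fun h' => h.lt.not_ge h'.2⟩, ?_⟩
  rintro (c | ⟨t, c⟩ | ⟨t, q⟩) h₁ h₂
  · exact h₁.le
  · obtain ⟨rfl, -⟩ := h₁.le
    exact h.2 (c := c) (lt_of_le_not_ge h₁.le.2 fun h' => h₁.not_ge ⟨rfl, h'⟩)
      (lt_of_le_not_ge h₂.le.2 fun h' => h₂.not_ge ⟨rfl, h'⟩)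
  · exact h₁.le

theorem nextOrder_covBy_root (s : X.I) :
    @CovBy X.next.V O.nextOrder.toLT (.inl (O.leaf s)) (.inr (.inl (s, O.root))) := by
  let := O.toPartialOrder
  let := O.nextOrder
  refine ⟨⟨le_refl (O.leaf s), id⟩, ?_⟩
  rintro (c | ⟨t, c⟩ | ⟨t, q⟩) h₁ h₂
  · exact h₁.not_ge h₂.le
  · exact h₂.not_ge ⟨h₂.le.1.symm, O.root_le c⟩
  · exact h₂.le

theorem nextOrder_covBy_new (s q : X.I) :
    @CovBy X.next.V O.nextOrder.toLT (.inl (O.leaf s)) (.inr (.inr (s, q))) := by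
  let := O.toPartialOrder
  let := O.nextOrder
  refine ⟨⟨le_refl (O.leaf s), id⟩, ?_⟩
  rintro (c | ⟨t, c⟩ | ⟨t, p⟩) h₁ h₂
  · exact h₁.not_ge h₂.le
  · exact h₂.le
  · exact h₂.not_ge ⟨h₂.le.1.symm, h₂.le.2.symm⟩

end Covering

/-- The Burling order on the next graph of Burling's construction. -/
noncomputable def next (O : BurlingOrder X) : BurlingOrder X.next where
  toPartialOrder := O.nextOrder
  root := .inl O.root
  root_le := by
    rintro (a | ⟨s, a⟩ | ⟨s, q⟩)
    · exact O.root_le a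
    · exact O.root_le (O.leaf s)
    · exact O.root_le (O.leaf s)
  le_total_of_le := by
    rintro (a | ⟨s, a⟩ | ⟨s, q⟩) (b | ⟨t, b⟩ | ⟨t, p⟩) (c | ⟨u, c⟩ | ⟨u, r⟩) h₁ h₂ <;>
      simp only [LE.le, nextLe] at h₁ h₂ ⊢
    · exact O.le_total_of_le a b c h₁ h₂
    · exact O.le_total_of_le a b _ h₁ h₂
    · exact O.le_total_of_le a b _ h₁ h₂
    · exact Or.inl (h₂.1 ▸ h₁)
    · exact Or.inl (h₂.1 ▸ h₁)
    · exact Or.inr (h₁.1 ▸ h₂)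
    · exact (O.le_total_of_le a b c h₁.2 h₂.2).imp (fun h => ⟨h₁.1.trans h₂.1.symm, h⟩)
        fun h => ⟨h₂.1.trans h₁.1.symm, h⟩
    · exact Or.inr (h₁.1 ▸ h₂)
    · exact Or.inl ⟨h₁.1.trans h₂.1.symm, h₁.2.trans h₂.2.symm⟩
  lastBorn := O.nextLastBorn
  lastBorn_child := by
    let := O.toPartialOrder
    let := O.nextOrder
    rintro (a | ⟨s, a⟩ | ⟨s, q⟩) h
    · by_cases ha : ∃ s, O.leaf s = a
      · obtain ⟨s, rfl⟩ := ha
        rw [nextLastBorn_leaf]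
        exact O.nextOrder_covBy_root s
      · rw [nextLastBorn_inl O ha]
        exact O.nextOrder_covBy_inl (O.lastBorn_child a ((O.isMax_iff a).not.2 ha))
    · refine O.nextOrder_covBy_copy s (O.lastBorn_child a fun ha => h ?_)
      rintro (b | ⟨t, b⟩ | ⟨t, p⟩) hb
      · exact False.elim hb
      · exact ⟨hb.1.symm, ha hb.2⟩
      · exact False.elim hb
    · refine (h ?_).elim
      rintro (b | ⟨t, b⟩ | ⟨t, p⟩) hb
      · exact False.elim hb
      · exact False.elim hb
      · exact ⟨hb.1.symm, hb.2.symm⟩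
  leaf
    | .inl (s, q) => .inr (.inl (s, O.leaf q))
    | .inr (s, q) => .inr (.inr (s, q))
  leaf_injective := by
    rintro (⟨s, q⟩ | ⟨s, q⟩) (⟨t, p⟩ | ⟨t, p⟩) h
    · have h' := Sum.inl.inj (Sum.inr.inj h)
      rw [Prod.mk.injEq] at h'
      rw [h'.1, O.leaf_injective h'.2]
    · cases h
    · cases h
    · rw [Sum.inr.inj (Sum.inr.inj h)]
  isMax_iff := by
    let := O.toPartialOrder
    let := O.nextOrder
    rintro (a | ⟨s, a⟩ | ⟨s, q⟩)
    · constructor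
      · intro h
        by_cases ha : ∃ s, O.leaf s = a
        · obtain ⟨s, rfl⟩ := ha
          exact (h.not_lt (O.nextOrder_covBy_root s).lt).elim
        · have := O.lastBorn_child a ((O.isMax_iff a).not.2 ha)
          exact (h.not_lt (O.nextOrder_covBy_inl this).lt).elim
      · rintro ⟨⟨s, q⟩ | ⟨s, q⟩, h⟩ <;> cases h
    · constructor
      · intro h
        obtain ⟨q, rfl⟩ := (O.isMax_iff a).1 fun b hb =>
          (h (b := .inr (.inl (s, b))) ⟨rfl, hb⟩).2
        exact ⟨.inl (s, q), rfl⟩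
      · rintro ⟨⟨t, q⟩ | ⟨t, q⟩, h⟩
        · obtain ⟨rfl, rfl⟩ := Prod.mk.inj (Sum.inl.inj (Sum.inr.inj h))
          rintro (b | ⟨u, b⟩ | ⟨u, p⟩) hb
          · exact False.elim hb
          · exact ⟨hb.1.symm, (O.isMax_iff _).2 ⟨q, rfl⟩ hb.2⟩
          · exact False.elim hb
        · cases h
    · refine ⟨fun _ => ⟨.inr (s, q), rfl⟩, fun _ => ?_⟩
      rintro (b | ⟨t, b⟩ | ⟨t, p⟩) hb
      · exact False.elim hb
      · exact False.elim hb
      · exact ⟨hb.1.symm, hb.2.symm⟩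
  mem_sets := by
    rintro (⟨s, q⟩ | ⟨s, q⟩) x
    · exact (O.next_mem_sets s q x).1
    · exact (O.next_mem_sets s q x).2
  choose u := {v | O.nextMem u v}
  choose_branch := by
    let := O.toPartialOrder
    let := O.nextOrder
    have hIcc : ∀ {u l b : X.next.V}, (∀ x, O.nextMem u x ↔ O.nextLe l x ∧ O.nextLe x b) →
        {v : X.next.V | O.nextMem u v} = Set.Icc l b := fun h => Set.ext h
    have hempty : ∀ {u : X.next.V}, (∀ x, ¬ O.nextMem u x) →
        {v : X.next.V | O.nextMem u v} = ∅ := fun h => Set.eq_empty_of_forall_notMem h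
    have hmem : ∀ {a l b : X.V}, O.choose a = Set.Icc l b →
        ∀ x, x ∈ O.choose a ↔ O.le l x ∧ O.le x b := fun h x => by rw [h]; rfl
    rintro (a | ⟨s, a⟩ | ⟨s, q⟩)
    · rcases O.choose_branch a with h | ⟨p, b, hp, hne, hb, h⟩
      · refine Or.inl (hempty ?_)
        rintro (x | ⟨t, x⟩ | ⟨t, r⟩) <;> simp [nextMem, h]
      · have hp' : ¬ ∃ s, O.leaf s = p := (O.isMax_iff p).not.1 hp.lt.not_isMax
        refine Or.inr ⟨.inl p, .inl b, O.nextOrder_covBy_inl hp, ?_⟩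
        rw [nextLastBorn_inl O hp']
        refine ⟨fun he => hne (Sum.inl.inj he), hb, hIcc ?_⟩
        rintro (x | ⟨t, x⟩ | ⟨t, r⟩) <;> simp [nextMem, nextLe, hmem h]
    · rcases O.choose_branch a with h | ⟨p, b, hp, hne, hb, h⟩
      · refine Or.inl (hempty ?_)
        rintro (x | ⟨t, x⟩ | ⟨t, r⟩) <;> simp [nextMem, h]
      · refine Or.inr ⟨.inr (.inl (s, p)), .inr (.inl (s, b)), O.nextOrder_covBy_copy s hp,
          fun he => hne (Prod.mk.inj (Sum.inl.inj (Sum.inr.inj he))).2, ⟨rfl, hb⟩, hIcc ?_⟩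
        rintro (x | ⟨t, x⟩ | ⟨t, r⟩)
        · simp [nextMem, nextLastBorn, nextLe]
        · simp only [nextMem, nextLastBorn, nextLe, hmem h]
          exact ⟨fun h => ⟨⟨h.1, h.2.1⟩, h.1.symm, h.2.2⟩, fun h => ⟨h.1.1, h.1.2, h.2.2⟩⟩
        · simp [nextMem, nextLastBorn, nextLe]
    · refine Or.inr ⟨.inl (O.leaf s), .inr (.inl (s, O.leaf q)), O.nextOrder_covBy_new s q, ?_⟩
      rw [nextLastBorn_leaf]
      refine ⟨fun he => Sum.inl_ne_inr (Sum.inr.inj he), ⟨rfl, O.root_le _⟩, hIcc ?_⟩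
      rintro (x | ⟨t, x⟩ | ⟨t, r⟩)
      · simp [nextMem, nextLe]
      · simp only [nextMem, nextLe, O.mem_sets]
        exact ⟨fun h => ⟨⟨h.1, O.root_le x⟩, h.1.symm, h.2⟩, fun h => ⟨h.1.1, h.2.2⟩⟩
      · simp [nextMem, nextLe]
  adj_iff := O.nextAdj_iff

/-- The one-vertex Burling tree. -/
def unit : BurlingOrder ⟨Unit, ⊥, Unit, fun _ => Set.univ⟩ where
  toPartialOrder := inferInstanceAs (PartialOrder Unit)
  root := ()
  root_le _ := le_rfl
  le_total_of_le _ _ _ _ _ := Or.inl le_rfl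
  lastBorn _ := ()
  lastBorn_child v hv := (hv fun _ _ => le_rfl).elim
  leaf _ := ()
  leaf_injective _ _ _ := rfl
  isMax_iff v := ⟨fun _ => ⟨(), rfl⟩, fun _ _ _ => le_rfl⟩
  mem_sets _ _ := ⟨fun _ => le_rfl, fun _ => trivial⟩
  choose _ := ∅
  choose_branch _ := Or.inl rfl
  adj_iff u v := by simp

/-- The Burling order on the `n`-th graph of the Burling sequence. -/
noncomputable def burling : ∀ n : ℕ, BurlingOrder (burlingSystem n)
  | 0 => unit
  | n + 1 => (burling n).next

end BurlingOrder

theorem mem_inter_of_mem_burlingGraphs {V : Type} {G : SimpleGraph V} (hG : burlingGraphs.Mem G) :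
    (triviallyPerfect.inter burlingStronglyChordal).Mem G := by
  obtain ⟨n, hn⟩ := hG
  have := (burlingSystem_finite n).1
  exact (triviallyPerfect.inter burlingStronglyChordal).hereditary
    (hn.trans (BurlingOrder.burling n).isIndContained_derivedGraph)
    (BurlingTree.derivedGraph_mem_inter _)

theorem BurlingTree.derivedGraph_cliqueFree (B : BurlingTree) : B.derivedGraph.CliqueFree 3 := by
  classical
  intro S hS
  obtain ⟨v, hv, hlast⟩ := exists_last (S : Set B.T) (by
    simp [← Finset.card_pos, hS.card_eq])
  have hnbr : ∀ w ∈ S.erase v, w ∈ B.choose v := by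
    intro w hw
    obtain ⟨hne, hw⟩ := Finset.mem_erase.1 hw
    rcases derivedGraph_adj.1 (hS.isClique hv hw hne.symm) with h | h
    · exact h
    · obtain ⟨l, hl, hlv, -⟩ := exists_lastBornSibling_of_mem_choose h
      exact (hlast w hw (Or.inr ⟨w, l, le_rfl, hl, hlv⟩)).elim
  have hcard : (S.erase v).card = 2 := by rw [Finset.card_erase_of_mem hv, hS.card_eq]
  obtain ⟨x, y, hxy, he⟩ := Finset.card_eq_two.1 hcard
  have hx : x ∈ S.erase v := by simp [he]
  have hy : y ∈ S.erase v := by simp [he]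
  have hchain := le_total_of_mem_choose (hnbr x hx) (hnbr y hy)
  rcases derivedGraph_adj.1 (hS.isClique (Finset.mem_of_mem_erase hx)
    (Finset.mem_of_mem_erase hy) hxy) with h | h
  · exact hchain.elim (not_le_of_mem_choose h) (not_ge_of_mem_choose h)
  · exact hchain.elim (not_ge_of_mem_choose h) (not_le_of_mem_choose h)

theorem cliqueFree_of_mem_burlingGraphs {V : Type} {G : SimpleGraph V}
    (hG : burlingGraphs.Mem G) : G.CliqueFree 3 := by
  obtain ⟨n, hn⟩ := hG
  have := (burlingSystem_finite n).1
  obtain ⟨f⟩ := hn.trans (BurlingOrder.burling n).isIndContained_derivedGraph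
  exact (BurlingTree.derivedGraph_cliqueFree _).comap f.toCopy.isContained

/-- If every proper coloring of `X.graph` has `k` colors on some distinguished set of `X`, then
every proper coloring of the next graph has `k + 1` colors on some distinguished set. -/
theorem GraphWithSets.exists_many_colors_next {X : GraphWithSets} [Finite X.V] {α : Type} {k : ℕ}
    (hX : ∀ C : X.graph.Coloring α, ∃ s, k ≤ (C '' X.sets s).ncard)
    (C : X.next.graph.Coloring α) : ∃ s, k + 1 ≤ (C '' X.next.sets s).ncard := by
  let f : X.NextV → α := C
  have hf : ∀ u v : X.NextV, X.nextAdj u v → f u ≠ f v := fun u v h => C.valid h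
  obtain ⟨s, hs⟩ := hX (SimpleGraph.Coloring.mk (fun a => f (.inl a)) fun {a b} h => hf _ _ h)
  obtain ⟨q, hq⟩ := hX (SimpleGraph.Coloring.mk (fun a => f (.inr (.inl (s, a)))) fun {a b} h =>
    hf _ _ ⟨rfl, h⟩)
  set S : Set α := (fun a => f (.inl a)) '' X.sets s
  set Q : Set α := (fun a => f (.inr (.inl (s, a)))) '' X.sets q
  have hs : k ≤ S.ncard := hs
  have hq : k ≤ Q.ncard := hq
  have hSfin : S.Finite := Set.toFinite _
  have hQfin : Q.Finite := Set.toFinite _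
  set c := f (.inr (.inr (s, q)))
  have hcQ : c ∉ Q := by
    rintro ⟨b, hb, he⟩
    exact hf (.inr (.inl (s, b))) (.inr (.inr (s, q))) ⟨rfl, hb⟩ he
  have hinl : C '' X.next.sets (.inl (s, q)) = S ∪ Q := by
    change f '' (Sum.inl '' X.sets s ∪ (fun b => Sum.inr (Sum.inl (s, b))) '' X.sets q) = _
    rw [Set.image_union, Set.image_image, Set.image_image]
  have hinr : C '' X.next.sets (.inr (s, q)) = insert c S := by
    change f '' (Sum.inl '' X.sets s ∪ {Sum.inr (Sum.inr (s, q))}) = _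
    rw [Set.image_union, Set.image_image, Set.image_singleton, Set.union_singleton]
  by_cases hcS : c ∈ S
  · refine ⟨.inl (s, q), ?_⟩
    rw [hinl]
    calc k + 1 ≤ Q.ncard + 1 := Nat.succ_le_succ hq
      _ = (insert c Q).ncard := (Set.ncard_insert_of_notMem hcQ hQfin).symm
      _ ≤ (S ∪ Q).ncard := Set.ncard_le_ncard
        (Set.insert_subset (Or.inl hcS) Set.subset_union_right) (hSfin.union hQfin)
  · refine ⟨.inr (s, q), ?_⟩
    rw [hinr, Set.ncard_insert_of_notMem hcS hSfin]
    exact Nat.succ_le_succ hs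

theorem exists_many_colors_burlingSystem (n : ℕ) {α : Type}
    (C : (burlingSystem n).graph.Coloring α) :
    ∃ s, n + 1 ≤ (C '' (burlingSystem n).sets s).ncard := by
  induction n with
  | zero =>
    refine ⟨(), ?_⟩
    let f : Unit → α := C
    change 0 + 1 ≤ (f '' Set.univ).ncard
    rw [Set.univ_unique, Set.image_singleton, Set.ncard_singleton]
  | succ n ih =>
    have := (burlingSystem_finite n).1
    exact GraphWithSets.exists_many_colors_next ih C

theorem le_chromaticNumber_burlingGraph (n : ℕ) :
    ((n + 1 : ℕ) : ℕ∞) ≤ (burlingGraph n).chromaticNumber := by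
  refine SimpleGraph.le_chromaticNumber_iff_colorable.2 fun m hm => ?_
  obtain ⟨C⟩ := hm
  obtain ⟨s, hs⟩ := exists_many_colors_burlingSystem n C
  exact_mod_cast hs.trans ((Set.ncard_le_card _).trans_eq (by simp))

theorem not_intersectionwiseChiGuarding_triviallyPerfect :
    ¬ triviallyPerfect.IntersectionwiseChiGuarding := by
  intro h
  obtain ⟨f, hf, hbound⟩ := h _ burlingStronglyChordal_chiBounded
  have hG : burlingGraphs.Mem (burlingGraph (f 2)) := ⟨f 2, .rfl⟩
  have hclique : (burlingGraph (f 2)).cliqueNum ≤ 2 := by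
    obtain ⟨s, hs⟩ := (burlingGraph (f 2)).exists_isNClique_cliqueNum
    by_contra! hlt
    exact ((cliqueFree_of_mem_burlingGraphs hG).mono hlt) s hs
  have h₁ := (le_chromaticNumber_burlingGraph (f 2)).trans
    (hbound _ _ (mem_inter_of_mem_burlingGraphs hG))
  have h₂ : f 2 + 1 ≤ f (burlingGraph (f 2)).cliqueNum := by exact_mod_cast h₁
  exact absurd (h₂.trans (hf hclique)) (by omega)

theorem mainTheorem6 :
    ¬ triviallyPerfect.IntersectionwiseChiGuarding ∧
    burlingStronglyChordal.ChiBounded ∧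
    (∀ (V : Type) (G : SimpleGraph V), burlingStronglyChordal.Mem G → IsStronglyChordal G) ∧
    (∀ (V : Type) (G : SimpleGraph V),
      burlingGraphs.Mem G → (triviallyPerfect.inter burlingStronglyChordal).Mem G) ∧
    (∀ (V : Type) (G : SimpleGraph V), burlingGraphs.Mem G → G.CliqueFree 3) ∧
    (∀ n : ℕ, ((n + 1 : ℕ) : ℕ∞) ≤ (burlingGraph n).chromaticNumber) :=
  ⟨not_intersectionwiseChiGuarding_triviallyPerfect, burlingStronglyChordal_chiBounded,
    fun _ _ hG => (hasSimpleVertices_of_mem_burlingStronglyChordal hG).isStronglyChordal,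
    fun _ _ => mem_inter_of_mem_burlingGraphs, fun _ _ => cliqueFree_of_mem_burlingGraphs,
    le_chromaticNumber_burlingGraph⟩
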